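/- Let $S$ be a semiring (not necessarily commutative) that is positive ($a+b=0$ implies $a=0=b$) and a semifield (for every $a\neq 0$ there is $x$ with $ax=xa=1$). Let $\mathcal P$ be the powerset monad on $\mathbf{Set}$ (unit $x\mapsto\{x\}$, multiplication union), and let $\mathcal S$ be the semimodule monad on $\mathbf{Set}$: $\mathcal S X$ is the set of finitely supported functions $X\to S$, $\mathcal S(f)(\varphi)(y)=\sum_{x\in f^{-1}\{y\}}\varphi(x)$, the unit sends $x$ to the Dirac function at $x$, and the multiplication is $\mu^{\mathcal S}_X(\Psi)(x)=\sum_{\varphi}\Psi(\varphi)\,\varphi(x)$. For an $\mathcal S$-algebra $(X,a)$ and $B\subseteq X$, the convex closure of $B$ is $\overline{B}^{\,a}=\{a(\varphi)\mid \varphi\in\mathcal S X,\ \operatorname{supp}\varphi\subseteq B,\ \sum_{x}\varphi(x)=1\}$; $B$ is $a$-convex if $B=\overline{B}^{\,a}$, and $\mathcal P_c^aX$ denotes the set of $a$-convex subsets of $X$. For $\Phi\in\mathcal S\mathcal P X$ let $c(\Phi)=\{\mathcal S(u)(\Phi|_{\operatorname{supp}\Phi})\mid u\colon\operatorname{supp}\Phi\to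 X,\ u(A)\in A \text{ for all } A\}$. A weak distributive law $\delta\colon\mathcal S\mathcal P\to\mathcal P\mathcal S$ is a natural transformation satisfying all axioms of a distributive law except the one for the unit of $\mathcal S$. A weak lifting of $\mathcal P$ to the category $\mathrm{EM}(\mathcal S)$ of $\mathcal S$-algebras, with forgetful functor $U$, is a monad $\tilde{\mathcal P}$ on $\mathrm{EM}(\mathcal S)$ with natural transformations $\iota\colon U\tilde{\mathcal P}\to\mathcal P U$ and $\pi\colon\mathcal P U\to U\tilde{\mathcal P}$ such that $\pi\iota=\mathrm{id}$ and both are compatible with the units and multiplications of $\tilde{\mathcal P}$ and $\mathcal P$. It is determined by $\delta$ if, for all algebras $(X,a)$ and all morphisms $f\colon(X,a)\to(X',a')$, $\iota_{(X,a)}\circ\pi_{(X,a)}=\mathcal P a\circ\delta_X\circ\eta^{\mathcal S}_{\mathcal P X}$, the algebra $\tilde{\mathcal P}(X,a)$ has structure map $\pi_{(X,a)}\circ\mathcal P a\circ\delta_X\circ\mathcal S\iota_{(X,a)}$, the underlying map of $\tilde{\mathcal P}f$ is $\pi_{(X',a')}\circ\mathcal P f\circ\iota_{(X,a)}$, and conversely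 $\delta_X=\iota\circ b\circ\mathcal S\pi\circ\mathcal S\mathcal P\eta^{\mathcal S}_X$ for every set $X$, where $\iota,\pi$ are taken at the free algebra $(\mathcal S X,\mu^{\mathcal S}_X)$ and $b$ is the structure map of $\tilde{\mathcal P}(\mathcal S X,\mu^{\mathcal S}_X)$. **Theorem.** The canonical weak distributive law $\delta\colon\mathcal S\mathcal P\to\mathcal P\mathcal S$ exists; that is, the maps $\delta_X$ given by applying the Barr extension of $\mathcal S$ to the relation $\ni_X=\{(A,x)\mid x\in A\}\subseteq\mathcal P X\times X$, $$\delta_X(\Phi)=\{\mathcal S(p_2)(\psi)\mid \psi\in\mathcal S(\ni_X),\ \mathcal S(p_1)(\psi)=\Phi\}$$ with projections $p_1\colon\ni_X\to\mathcal P X$ and $p_2\colon\ni_X\to X$, form a weak distributive law. For all sets $X$ and $\Phi\in\mathcal S\mathcal P X$ it is given by $\delta_X(\Phi)=\overline{c(\Phi)}^{\,\mu^{\mathcal S}_X}$. The canonical weak lifting of $\mathcal P$ to $\mathrm{EM}(\mathcal S)$ determined by $\delta$ is the monad $(\tilde{\mathcal P},\eta^{\tilde{\mathcal P}},\mu^{\tilde{\mathcal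 P}})$ with natural transformations $\iota,\pi$ given as follows, for every $\mathcal S$-algebra $(X,a)$: * $\tilde{\mathcal P}(X,a)=(\mathcal P_c^aX,\alpha_a)$ with $\alpha_a(\Phi)=\{a(\varphi)\mid\varphi\in c(\mathcal S(\iota_{(X,a)})(\Phi))\}$ for $\Phi\in\mathcal S\mathcal P_c^aX$; * $\tilde{\mathcal P}(f)(A)=f(A)$, the direct image, for $f\colon(X,a)\to(X',a')$ and $A\in\mathcal P_c^aX$; * $\eta^{\tilde{\mathcal P}}_{(X,a)}(x)=\{x\}$, and $\mu^{\tilde{\mathcal P}}_{(X,a)}(\mathcal A)=\bigcup_{A\in\mathcal A}A$ for every $\alpha_a$-convex $\mathcal A\subseteq\mathcal P_c^aX$; * $\iota_{(X,a)}\colon\mathcal P_c^aX\to\mathcal P X$ is the inclusion, and $\pi_{(X,a)}(B)=\overline{B}^{\,a}$ for $B\subseteq X$. In particular all these maps are well defined, and these data form a weak lifting. -/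

import Mathlib

open CategoryTheory

universe v u

section General

variable {C : Type u} [Category.{v} C]

/-- A weak distributive law `δ : TS ⟶ ST` between monads `S` and `T` on `C`: all the axioms of a
distributive law except the one for the unit of `T`. (Mathlib composes functors from left to
right, so the functor `TS` is `S ⋙ T`.) -/
structure WeakDistributiveLaw (S T : CategoryTheory.Monad C) where
  δ : S.toFunctor ⋙ T.toFunctor ⟶ T.toFunctor ⋙ S.toFunctor
  mul_left : ∀ X : C,
    δ.app (S.obj X) ≫ S.map (δ.app X) ≫ S.μ.app (T.obj X) = T.map (S.μ.app X) ≫ δ.app X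
  mul_right : ∀ X : C,
    T.map (δ.app X) ≫ δ.app (T.obj X) ≫ S.map (T.μ.app X) = T.μ.app (S.obj X) ≫ δ.app X
  unit_left : ∀ X : C, T.map (S.η.app X) ≫ δ.app X = S.η.app (T.obj X)

/-- A weak lifting of the monad `S` to the Eilenberg–Moore category of the monad `T`: a monad
`lift` on `T`-algebras, with natural transformations `ι : U lift ⟶ S U` and `π : S U ⟶ U lift`
(where `U` forgets the algebra structure) such that `π ∘ ι = id`, both compatible with the
units and the multiplications. -/
structure WeakLifting (S T : CategoryTheory.Monad C) where
  lift : CategoryTheory.Monad T.Algebra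
  ι : lift.toFunctor ⋙ T.forget ⟶ T.forget ⋙ S.toFunctor
  π : T.forget ⋙ S.toFunctor ⟶ lift.toFunctor ⋙ T.forget
  ι_π : ι ≫ π = 𝟙 (lift.toFunctor ⋙ T.forget)
  ι_mul : ∀ A : T.Algebra,
    ι.app (lift.obj A) ≫ S.map (ι.app A) ≫ S.μ.app A.A = (lift.μ.app A).f ≫ ι.app A
  ι_unit : ∀ A : T.Algebra, (lift.η.app A).f ≫ ι.app A = S.η.app A.A
  π_mul : ∀ A : T.Algebra,
    S.map (π.app A) ≫ π.app (lift.obj A) ≫ (lift.μ.app A).f = S.μ.app A.A ≫ π.app A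
  π_unit : ∀ A : T.Algebra, S.η.app A.A ≫ π.app A = (lift.η.app A).f

/-- The weak lifting `L` is the one determined by the weak distributive law `D`:
* for each algebra `(X, a)`, the maps `π` and `ι` split the idempotent
  `S a ∘ δ_X ∘ η^T_{S X}` of `S X`;
* the structure map of the lifted algebra is `π ∘ S a ∘ δ_X ∘ T ι`;
* the lifted functor acts on `f : (X, a) ⟶ (X', a')` as `π ∘ S f ∘ ι`;
* conversely, `δ_X` is recovered from `L` as `ι ∘ b ∘ T π ∘ T S η^T_X`, where `π`, `ι` are taken
  at the free algebra `(T X, μ^T_X)` and `b` is the structure map of its lifting.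
The unit and multiplication are then forced by the axioms of a weak lifting, as `ι` is split
mono. -/
structure WeakLifting.IsInducedBy {S T : CategoryTheory.Monad C} (L : WeakLifting S T)
    (D : WeakDistributiveLaw S T) : Prop where
  splitting : ∀ A : T.Algebra,
    L.π.app A ≫ L.ι.app A = T.η.app (S.obj A.A) ≫ D.δ.app A.A ≫ S.map A.a
  action : ∀ A : T.Algebra,
    (L.lift.obj A).a = T.map (L.ι.app A) ≫ D.δ.app A.A ≫ S.map A.a ≫ L.π.app A
  map : ∀ {A B : T.Algebra} (f : A ⟶ B),
    (L.lift.map f).f = L.ι.app A ≫ S.map f.f ≫ L.π.app B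
  law : ∀ X : C,
    D.δ.app X = T.map (S.map (T.η.app X)) ≫ T.map (L.π.app (T.free.obj X)) ≫
      (L.lift.obj (T.free.obj X)).a ≫ L.ι.app (T.free.obj X)

end General

theorem sUnion_image_sUnion {X : Type u} (U : Set (Set (Set X))) :
    ⋃₀ ((fun V : Set (Set X) => ⋃₀ V) '' U) = ⋃₀ (⋃₀ U) := by
  ext x
  simp only [Set.sUnion_image, Set.mem_iUnion, Set.mem_sUnion]
  exact ⟨fun ⟨V, hV, A, hA, hx⟩ => ⟨A, ⟨V, hV, hA⟩, hx⟩,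
    fun ⟨A, ⟨V, hV, hA⟩, hx⟩ => ⟨V, hV, A, hA, hx⟩⟩

/-- The powerset monad on sets. -/
def powersetMonad : CategoryTheory.Monad (Type u) where
  obj X := Set X
  map f := ↾fun A => (fun x => f x) '' A
  map_id X := by
    refine ConcreteCategory.hom_ext _ _ fun A => ?_
    exact Set.image_id A
  map_comp f g := by
    refine ConcreteCategory.hom_ext _ _ fun A => ?_
    exact Set.image_comp (fun y => g y) (fun x => f x) A
  η := { app := fun X => ↾fun x => ({x} : Set X)
         naturality := fun X Y f => by
          refine ConcreteCategory.hom_ext _ _ fun x => ?_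
          exact (Set.image_singleton (f := fun x => f x) (a := x)).symm }
  μ := { app := fun X => ↾fun U : Set (Set X) => ⋃₀ U
         naturality := fun X Y f => by
          refine ConcreteCategory.hom_ext _ _ fun U => ?_
          exact (Set.image_sUnion (f := fun x => f x) (s := U)).symm }
  assoc X := by
    refine ConcreteCategory.hom_ext _ _ fun U => ?_
    exact sUnion_image_sUnion U
  left_unit X := by
    refine ConcreteCategory.hom_ext _ _ fun A => ?_
    exact Set.sUnion_singleton A
  right_unit X := by
    refine ConcreteCategory.hom_ext _ _ fun A => ?_
    change ⋃₀ ((fun x : X => ({x} : Set X)) '' A) = A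
    rw [Set.sUnion_image]; exact Set.biUnion_of_singleton A

section Semimodule

variable (S : Type u) [Semiring S]

variable {S} in
/-- The formal linear combination `Ψ` of elements of `X →₀ S`, evaluated: the function
`x ↦ ∑ φ, Ψ φ * φ x`. -/
noncomputable def linComb {X : Type u} (Ψ : (X →₀ S) →₀ S) : X →₀ S :=
  Ψ.sum fun φ s => s • φ

theorem linComb_mapDomain {X Y : Type u} (g : Y → X →₀ S) (Ψ : Y →₀ S) :
    linComb (Finsupp.mapDomain g Ψ) = Ψ.sum fun y s => s • g y :=
  Finsupp.sum_mapDomain_index (fun _ => zero_smul _ _) (fun _ _ _ => add_smul _ _ _)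

theorem mapDomain_linComb {X Y : Type u} (f : X → Y) (Ψ : (X →₀ S) →₀ S) :
    linComb (Finsupp.mapDomain (Finsupp.mapDomain f) Ψ) = Finsupp.mapDomain f (linComb Ψ) := by
  rw [linComb_mapDomain, linComb, Finsupp.sum, Finsupp.sum, Finsupp.mapDomain_finsetSum]
  exact Finset.sum_congr rfl fun φ _ => (Finsupp.mapDomain_smul _ _).symm

theorem linComb_assoc {X : Type u} (Θ : ((X →₀ S) →₀ S) →₀ S) :
    linComb (Finsupp.mapDomain linComb Θ) = linComb (linComb Θ) := by
  rw [linComb_mapDomain]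
  conv_rhs => rw [linComb, linComb]
  rw [Finsupp.sum_sum_index (h := fun (φ : X →₀ S) (s : S) => s • φ)
    (fun _ => zero_smul _ _) (fun _ _ _ => add_smul _ _ _)]
  refine Finset.sum_congr rfl fun Ψ _ => ?_
  dsimp only
  rw [Finsupp.sum_smul_index (h := fun (φ : X →₀ S) (s : S) => s • φ)
    (fun _ => zero_smul _ _), linComb, Finsupp.smul_sum]
  exact Finset.sum_congr rfl fun φ _ => smul_smul _ _ _

theorem linComb_single {X : Type u} (φ : X →₀ S) : linComb (Finsupp.single φ 1) = φ := by
  rw [linComb, Finsupp.sum_single_index (h := fun (φ : X →₀ S) (s : S) => s • φ) (zero_smul _ _),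
    one_smul]

theorem linComb_mapDomain_single {X : Type u} (φ : X →₀ S) :
    linComb (Finsupp.mapDomain (fun x => Finsupp.single x 1) φ) = φ := by
  rw [linComb_mapDomain]
  simp

/-- The semimodule monad of a semiring `S`: a set `X` is sent to the set of finitely supported
functions `X → S`, a map `f` to `φ ↦ (y ↦ ∑ x ∈ f⁻¹ y, φ x)`, the unit is the Dirac function, and
the multiplication is `Ψ ↦ (x ↦ ∑ φ, Ψ φ * φ x)`. -/
noncomputable def semimoduleMonad : CategoryTheory.Monad (Type u) where
  obj X := X →₀ S
  map f := ↾fun φ => Finsupp.mapDomain (fun x => f x) φ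
  map_id X := by
    refine ConcreteCategory.hom_ext _ _ fun φ => ?_
    exact Finsupp.mapDomain_id
  map_comp f g := by
    refine ConcreteCategory.hom_ext _ _ fun φ => ?_
    exact Finsupp.mapDomain_comp (f := fun x => f x) (g := fun y => g y)
  η := { app := fun X => ↾fun x => (Finsupp.single x 1 : X →₀ S)
         naturality := fun X Y f => by
          refine ConcreteCategory.hom_ext _ _ fun x => ?_
          exact (Finsupp.mapDomain_single (f := fun x => f x)).symm }
  μ := { app := fun X => ↾fun Ψ : (X →₀ S) →₀ S => linComb Ψ
         naturality := fun X Y f => by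
          refine ConcreteCategory.hom_ext _ _ fun Ψ => ?_
          exact mapDomain_linComb S (fun x => f x) Ψ }
  assoc X := by
    refine ConcreteCategory.hom_ext _ _ fun Θ => ?_
    exact linComb_assoc S Θ
  left_unit X := by
    refine ConcreteCategory.hom_ext _ _ fun φ => ?_
    exact linComb_single S φ
  right_unit X := by
    refine ConcreteCategory.hom_ext _ _ fun φ => ?_
    exact linComb_mapDomain_single S φ

/-- A semiring is positive if `a + b = 0` only for `a = 0 = b`. -/
def IsPositiveSemiring : Prop := ∀ a b : S, a + b = 0 → a = 0 ∧ b = 0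

/-- A semiring is a semifield if each nonzero element has a two-sided multiplicative inverse
(multiplication is not required to be commutative). -/
def IsSemifieldSemiring : Prop := ∀ a : S, a ≠ 0 → ∃ x : S, a * x = 1 ∧ x * a = 1

variable {S}

/-- The convex closure of a subset `B` in an algebra `(X, a)` of the semimodule monad. -/
def convexClosure (A : (semimoduleMonad S).Algebra) (B : Set A.A) : Set A.A :=
  {x | ∃ φ : A.A →₀ S, (φ.support : Set A.A) ⊆ B ∧ (φ.sum fun _ s => s) = 1 ∧ A.a φ = x}

/-- The `a`-convex subsets of an algebra `(X, a)`. -/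
def ConvexSubset (A : (semimoduleMonad S).Algebra) : Type u :=
  {B : Set A.A // B = convexClosure A B}

/-- For `Φ` in `S (P X)`, the set of all `S(u)(Φ)`, where `u : supp Φ → X` chooses an element
`u B ∈ B` for each `B` in the support of `Φ` (and `Φ` is restricted to its support). -/
def choiceSet {X : Type u} (Φ : Set X →₀ S) : Set (X →₀ S) :=
  {φ | ∃ u : {B // B ∈ Φ.support} → X, (∀ B, u B ∈ B.1) ∧
    Finsupp.mapDomain u (Φ.subtypeDomain (· ∈ Φ.support)) = φ}

end Semimodule

/-- The Barr extension of an endofunctor `T` of sets to relations: for `R ⊆ X × Y` with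
projections `p : R → X` and `q : R → Y`, it relates `T(p)(w)` to `T(q)(w)` for all `w ∈ T R`. -/
def barrExtension (T : Type u ⥤ Type u) {X Y : Type u} (R : Set (X × Y)) :
    Set (T.obj X × T.obj Y) :=
  {z | ∃ w : T.obj R, T.map (↾fun r : R => r.1.1) w = z.1 ∧ T.map (↾fun r : R => r.1.2) w = z.2}

/-- The canonical (weak) distributive law of the powerset monad over `T` has as its component at
`X` the map `T (P X) → P (T X)` corresponding to the Barr extension of the membership relation
`{(B, x) | x ∈ B} ⊆ P X × X`. -/
def IsCanonicalLaw {T : CategoryTheory.Monad (Type u)}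
    (D : WeakDistributiveLaw powersetMonad T) : Prop :=
  ∀ (X : Type u) (Φ : T.obj (Set X)),
    D.δ.app X Φ = {φ : T.obj X |
      (Φ, φ) ∈ barrExtension T.toFunctor {p : Set X × X | p.2 ∈ p.1}}

/-- For a weak lifting of the powerset monad, the subset `ι B` of `X` given by an element `B` of
the carrier of the lifted algebra of `(X, a)`. -/
def WeakLifting.toSubset {T : CategoryTheory.Monad (Type u)} (L : WeakLifting powersetMonad T)
    (A : T.Algebra) (B : (L.lift.obj A).A) : Set A.A :=
  L.ι.app A B

/-- The weak lifting `L` of the powerset monad to algebras of the semimodule monad is given by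
convex subsets: `(X, a)` is sent to the set of its convex subsets, `ι` is the inclusion of convex
subsets into all subsets, `π` is convex closure, the algebra structure is
`Φ ↦ {a φ | φ ∈ c(S(ι)(Φ))}`, maps act by direct image, the unit is `x ↦ {x}` and the
multiplication is union. (As `ι` is the inclusion, the remaining clauses are stated as equalities
of subsets of the carrier.) -/
structure WeakLifting.IsConvexPowerset {S : Type u} [Semiring S]
    (L : WeakLifting powersetMonad (semimoduleMonad S)) : Prop where
  carrier : ∀ A, (L.lift.obj A).A = ConvexSubset A
  ι_eq : ∀ A (B : (L.lift.obj A).A), L.toSubset A B = (cast (carrier A) B).1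
  π_eq : ∀ A (B : Set A.A), L.toSubset A (L.π.app A B) = convexClosure A B
  action_eq : ∀ A (Φ : (L.lift.obj A).A →₀ S),
    L.toSubset A ((L.lift.obj A).a Φ) =
      {x : A.A | ∃ φ ∈ choiceSet (Finsupp.mapDomain (L.toSubset A) Φ), A.a φ = x}
  map_eq : ∀ {A A'} (f : A ⟶ A') (B : (L.lift.obj A).A),
    L.toSubset A' ((L.lift.map f).f B) = (fun x => f.f x) '' L.toSubset A B
  unit_eq : ∀ A (x : A.A), L.toSubset A ((L.lift.η.app A).f x) = {x}
  mul_eq : ∀ A (U : (L.lift.obj (L.lift.obj A)).A),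
    L.toSubset A ((L.lift.μ.app A).f U) = ⋃ B ∈ L.toSubset (L.lift.obj A) U, L.toSubset A B

/-! Everything rests on one description of the canonical law: `φ ∈ canonicalLaw Φ` if and only if
`φ` is a combination `∑ Φ(B) • t B` with each `t B` in `simplex B`, that is, supported in `B` and of
total weight one. Given a witness `ψ` on the membership relation, `t B` is the fibre of `ψ` over `B`
divided by its weight `Φ(B)`. Inverses make this possible, and positivity ensures that `ψ` has no
mass over sets outside the support of `Φ` (`exists_of_mem_canonicalLaw`). More generally the law
commutes with linear combinations (`mem_canonicalLaw_linearCombination`), so each axiom reduces to a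
statement about simplices.

The law sends the Dirac function at `B` to all of `simplex B` (`canonicalLaw_single`), so the
omitted unit axiom fails in general. The formula with the convex closure of `choiceSet Φ` holds
because each `t B` is a mixture of Dirac functions, and mixtures can be pulled out of scalar
multiples and finite sums (`linearCombination_mem_mixtureHull_choices`).

In an algebra, evaluating each `t B` first turns a choice of `t B` in `simplex B` into a choice of a
point in the convex closure of `B` (`mem_evaluate_canonicalLaw`). On convex subsets the closure
disappears: the lifted action selects one point from each set and evaluates. The laws of the lifted
monad are then those of direct images and unions. -/

section Mixtures

open Finsupp

variable {S : Type u} [Semiring S]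

/-! ### Positivity, division and linear combinations -/

theorem IsPositiveSemiring.eq_zero_of_sum_eq_zero (hpos : IsPositiveSemiring S) {I : Type*}
    {F : Finset I} {g : I → S} (h : ∑ i ∈ F, g i = 0) {i : I} (hi : i ∈ F) : g i = 0 := by
  classical
  rw [← Finset.add_sum_erase F g hi] at h
  exact (hpos _ _ h).1

theorem IsSemifieldSemiring.eq_zero_of_mul_eq_zero (hfield : IsSemifieldSemiring S) {a b : S}
    (ha : a ≠ 0) (h : a * b = 0) : b = 0 := by
  obtain ⟨x, -, hx⟩ := hfield a ha
  rw [← one_mul b, ← hx, mul_assoc, h, mul_zero]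

theorem IsPositiveSemiring.mul_eq_zero_of_linearCombination (hpos : IsPositiveSemiring S)
    {I X : Type*} {t : I → X →₀ S} {Φ : I →₀ S} {x : X}
    (h : linearCombination S t Φ x = 0) {i : I} (hi : i ∈ Φ.support) : Φ i * t i x = 0 := by
  rw [linearCombination_apply, Finsupp.sum_apply] at h
  exact hpos.eq_zero_of_sum_eq_zero (g := fun i => Φ i * t i x) h hi

theorem mapDomain_eq_linearCombination {I X : Type*} (u : I → X) (Φ : I →₀ S) :
    mapDomain u Φ = linearCombination S (fun i => single (u i) 1) Φ := by
  simp [linearCombination_apply, mapDomain]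

theorem mapDomain_linearCombination {I X Y : Type*} (f : X → Y) (t : I → X →₀ S) (Φ : I →₀ S) :
    mapDomain f (linearCombination S t Φ) = linearCombination S (fun i => mapDomain f (t i)) Φ :=
  apply_linearCombination S (lmapDomain S S f) t Φ

theorem linearCombination_congr {I M : Type*} [AddCommMonoid M] [Module S M] {t t' : I → M}
    {Φ : I →₀ S} (h : ∀ i ∈ Φ.support, t i = t' i) :
    linearCombination S t Φ = linearCombination S t' Φ := by
  rw [linearCombination_apply, linearCombination_apply]
  exact Finset.sum_congr rfl fun i hi => by simp only [h i hi]

theorem linComb_eq_linearCombination {X : Type u} (Ψ : (X →₀ S) →₀ S) :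
    linComb Ψ = linearCombination S id Ψ := rfl

theorem IsPositiveSemiring.mem_support_mapDomain (hpos : IsPositiveSemiring S) {I X : Type*}
    (u : I → X) {Φ : I →₀ S} {i : I} (hi : i ∈ Φ.support) : u i ∈ (mapDomain u Φ).support := by
  rw [mem_support_iff]
  intro h
  rw [mapDomain_eq_linearCombination] at h
  have := hpos.mul_eq_zero_of_linearCombination h hi
  rw [single_eq_same, mul_one] at this
  exact mem_support_iff.1 hi this

/-! ### Total weight and simplices -/

/-- The sum of the values of a finitely supported function. -/
noncomputable def totalWeight {X : Type*} : (X →₀ S) →ₗ[S] S :=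
  linearCombination S fun _ => 1

theorem totalWeight_apply {X : Type*} (φ : X →₀ S) : totalWeight φ = φ.sum fun _ s => s := by
  simp [totalWeight, linearCombination_apply]

theorem totalWeight_single {X : Type*} (x : X) (s : S) : totalWeight (single x s) = s := by
  simp [totalWeight]

theorem totalWeight_mapDomain {X Y : Type*} (f : X → Y) (φ : X →₀ S) :
    totalWeight (mapDomain f φ) = totalWeight φ := by
  simp only [totalWeight, linearCombination_mapDomain]
  rfl

theorem linearCombination_const {X M : Type*} [AddCommMonoid M] [Module S M] (m : M)
    (φ : X →₀ S) : linearCombination S (fun _ => m) φ = totalWeight φ • m := by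
  rw [totalWeight_apply, linearCombination_apply, Finsupp.sum, Finsupp.sum, Finset.sum_smul]

theorem totalWeight_linearCombination {I X : Type*} {t : I → X →₀ S} {Φ : I →₀ S}
    (h : ∀ i ∈ Φ.support, totalWeight (t i) = 1) :
    totalWeight (linearCombination S t Φ) = totalWeight Φ := by
  rw [apply_linearCombination]
  exact linearCombination_congr h

/-- The finitely supported functions of total weight one with support in `B`. -/
def simplex {X : Type*} (B : Set X) : Set (X →₀ S) :=
  {φ | (φ.support : Set X) ⊆ B ∧ totalWeight φ = 1}

theorem single_mem_simplex {X : Type*} {B : Set X} {x : X} (hx : x ∈ B) :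
    (single x 1 : X →₀ S) ∈ simplex B := by
  refine ⟨fun y hy => ?_, totalWeight_single _ _⟩
  have := support_single_subset hy
  rw [Finset.mem_singleton] at this
  exact this ▸ hx

theorem mapDomain_mem_simplex {X Y : Type*} {B : Set X} {C : Set Y} {f : X → Y} {φ : X →₀ S}
    (hφ : φ ∈ simplex B) (hf : ∀ x ∈ φ.support, f x ∈ C) : mapDomain f φ ∈ simplex C := by
  classical
  refine ⟨fun y hy => ?_, by rw [totalWeight_mapDomain, hφ.2]⟩
  obtain ⟨x, hx, rfl⟩ := Finset.mem_image.1 (mapDomain_support hy)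
  exact hf x hx

theorem linearCombination_mem_simplex {I X : Type*} {B : Set X} {t : I → X →₀ S} {Φ : I →₀ S}
    (hΦ : totalWeight Φ = 1) (ht : ∀ i ∈ Φ.support, t i ∈ simplex B) :
    linearCombination S t Φ ∈ simplex B := by
  refine ⟨fun x hx => ?_, by rw [totalWeight_linearCombination fun i hi => (ht i hi).2, hΦ]⟩
  rw [Finset.mem_coe, mem_support_iff, linearCombination_apply, Finsupp.sum_apply] at hx
  obtain ⟨i, hi, h⟩ := Finset.exists_ne_zero_of_sum_ne_zero hx
  refine (ht i hi).1 (mem_support_iff.2 fun h0 => h ?_)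
  simp [h0]

theorem eq_linearCombination_single {X : Type*} (φ : X →₀ S) :
    linearCombination S (fun x => single x (1 : S)) φ = φ := by
  rw [← mapDomain_eq_linearCombination]
  exact mapDomain_id

theorem eq_single_of_mem_simplex {X : Type*} {x : X} {φ : X →₀ S} (hφ : φ ∈ simplex {x}) :
    φ = single x 1 := by
  have h : linearCombination S (fun y => single y (1 : S)) φ
      = linearCombination S (fun _ => single x (1 : S)) φ :=
    linearCombination_congr fun y hy => by rw [show y = x from hφ.1 hy]
  rw [linearCombination_const, hφ.2, one_smul, ← mapDomain_eq_linearCombination] at h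
  exact (mapDomain_id (v := φ)).symm.trans h

/-- A preimage is built by lifting each Dirac function of the support separately and recombining
with the weights of `φ`. -/
theorem simplex_image {X Y : Type*} (f : X → Y) (B : Set X) :
    simplex (S := S) (f '' B) = mapDomain f '' simplex B := by
  refine Set.Subset.antisymm (fun φ hφ => ?_) ?_
  · have h : ∀ y ∈ φ.support, ∃ χ : X →₀ S, χ ∈ simplex B ∧ mapDomain f χ = single y 1 := by
      intro y hy
      obtain ⟨x, hx, rfl⟩ := hφ.1 hy
      exact ⟨single x 1, single_mem_simplex hx, mapDomain_single⟩
    choose! χ hχ using h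
    refine ⟨linearCombination S χ φ,
      linearCombination_mem_simplex hφ.2 fun y hy => (hχ y hy).1, ?_⟩
    rw [mapDomain_linearCombination, linearCombination_congr fun y hy => (hχ y hy).2]
    exact eq_linearCombination_single φ
  · rintro _ ⟨φ, hφ, rfl⟩
    exact mapDomain_mem_simplex hφ fun x hx => ⟨x, hφ.1 hx, rfl⟩

/-! ### The canonical law as a set of mixtures -/

/-- The image of `Φ` under the canonical law, that is, under the Barr extension of the membership
relation. -/
def canonicalLaw {X : Type u} (Φ : Set X →₀ S) : Set (X →₀ S) :=
  {φ | ∃ ψ : {p : Set X × X | p.2 ∈ p.1} →₀ S,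
    mapDomain (fun r => r.1.1) ψ = Φ ∧ mapDomain (fun r => r.1.2) ψ = φ}

/-- Witnesses on the membership relation combine linearly, and both projections are linear. No
condition on `S` enters here. -/
theorem linearCombination_mem_canonicalLaw {I : Type*} {X : Type u} {t : I → X →₀ S}
    {Ψ : I → Set X →₀ S} {Φ : I →₀ S} (h : ∀ i ∈ Φ.support, t i ∈ canonicalLaw (Ψ i)) :
    linearCombination S t Φ ∈ canonicalLaw (linearCombination S Ψ Φ) := by
  choose! ψ hψ using h
  refine ⟨linearCombination S ψ Φ, ?_, ?_⟩
  · rw [mapDomain_linearCombination]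
    exact linearCombination_congr fun i hi => (hψ i hi).1
  · rw [mapDomain_linearCombination]
    exact linearCombination_congr fun i hi => (hψ i hi).2

theorem simplex_subset_canonicalLaw {X : Type u} {B : Set X} {φ : X →₀ S} (hφ : φ ∈ simplex B) :
    φ ∈ canonicalLaw (single B 1) := by
  have h : linearCombination S (fun x => single x (1 : S)) φ ∈
      canonicalLaw (linearCombination S (fun _ => single B (1 : S)) φ) :=
    linearCombination_mem_canonicalLaw fun x hx =>
      ⟨single ⟨(B, x), hφ.1 hx⟩ 1, mapDomain_single, mapDomain_single⟩
  rw [linearCombination_const, hφ.2, one_smul, ← mapDomain_eq_linearCombination] at h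
  rwa [show mapDomain (fun x => x) φ = φ from mapDomain_id] at h

theorem mapDomain_apply_eq_totalWeight {I X : Type*} [DecidableEq X] (f : I → X) (ψ : I →₀ S)
    (x : X) : mapDomain f ψ x = totalWeight (ψ.filter (f · = x)) := by
  induction ψ using Finsupp.induction_linear with
  | zero => rw [filter_zero, map_zero]; simp
  | add a b ha hb => rw [mapDomain_add, Finsupp.add_apply, ha, hb, filter_add, map_add]
  | single i s =>
    rw [mapDomain_single]
    by_cases h : f i = x
    · rw [filter_single_of_pos (f · = x) h, totalWeight_single, h, single_eq_same]
    · rw [filter_single_of_neg (f · = x) h, map_zero, single_eq_of_ne (Ne.symm h)]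

/-- Each fibre of `ψ` is normalised. The left inverse of `Φ B` gives weight one; the right inverse
restores the fibre on multiplying back. -/
theorem exists_of_mem_canonicalLaw (hpos : IsPositiveSemiring S) (hfield : IsSemifieldSemiring S)
    {X : Type u} {Φ : Set X →₀ S} {φ : X →₀ S} (h : φ ∈ canonicalLaw Φ) :
    ∃ w : Set X → X →₀ S, (∀ B ∈ Φ.support, w B ∈ simplex B) ∧ linearCombination S w Φ = φ := by
  classical
  obtain ⟨ψ, rfl, rfl⟩ := h
  set Φ := mapDomain (fun r : {p : Set X × X | p.2 ∈ p.1} => r.1.1) ψ with hΦ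
  have hinv : ∀ B ∈ Φ.support, ∃ s : S, Φ B * s = 1 ∧ s * Φ B = 1 := fun B hB =>
    hfield _ (mem_support_iff.1 hB)
  choose! s hs using hinv
  refine ⟨fun B => s B • mapDomain (fun r => r.1.2) (ψ.filter (·.1.1 = B)), fun B hB => ⟨?_, ?_⟩,
    ?_⟩
  · refine fun x hx => ?_
    obtain ⟨r, hr, rfl⟩ := Finset.mem_image.1 (mapDomain_support (support_smul hx))
    rw [support_filter, Finset.mem_filter] at hr
    exact hr.2 ▸ r.2
  · rw [map_smul, totalWeight_mapDomain, ← mapDomain_apply_eq_totalWeight, smul_eq_mul]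
    exact (hs B hB).2
  · rw [linearCombination_apply, Finsupp.sum, Finset.sum_congr rfl fun B hB => by
      rw [smul_smul, (hs B hB).1, one_smul], ← mapDomain_finsetSum]
    -- It remains to see that the fibres over the support of `Φ` exhaust `ψ`: by positivity a point
    -- of nonzero weight cannot be projected outside that support.
    congr 1
    ext r
    rw [finsetSum_apply]
    simp only [filter_apply]
    rw [Finset.sum_ite_eq]
    split_ifs with hr
    · rfl
    · by_contra h
      exact hr (hpos.mem_support_mapDomain _ (mem_support_iff.2 (Ne.symm h)))

theorem linearCombination_single_one {X M : Type*} [AddCommMonoid M] [Module S M] (w : X → M)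
    (x : X) : linearCombination S w (single x 1) = w x := by simp

theorem canonicalLaw_single (hpos : IsPositiveSemiring S) (hfield : IsSemifieldSemiring S)
    {X : Type u} (B : Set X) : canonicalLaw (single B (1 : S)) = simplex B := by
  refine Set.Subset.antisymm (fun φ hφ => ?_) fun φ => simplex_subset_canonicalLaw
  obtain ⟨w, hw, rfl⟩ := exists_of_mem_canonicalLaw hpos hfield hφ
  rw [linearCombination_single_one]
  -- If `1 = 0` in `S`, then `single B 1` has empty support and `hw` says nothing, but then all
  -- functions coincide.
  rcases subsingleton_or_nontrivial S with _ | _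
  · have : w B = 0 := Subsingleton.elim _ _
    exact this ▸ ⟨by simp, Subsingleton.elim _ _⟩
  · exact hw B (by simp)

/-- One family `w` for the whole combination serves every `Ψ i` at once: as sums do not cancel and
there are no zero divisors, the support of `Ψ i` lies in that of the combination whenever `Φ i ≠ 0`.
-/
theorem mem_canonicalLaw_linearCombination (hpos : IsPositiveSemiring S)
    (hfield : IsSemifieldSemiring S) {I : Type*} {X : Type u} {Ψ : I → Set X →₀ S} {Φ : I →₀ S}
    {φ : X →₀ S} : φ ∈ canonicalLaw (linearCombination S Ψ Φ) ↔
      ∃ t : I → X →₀ S, (∀ i ∈ Φ.support, t i ∈ canonicalLaw (Ψ i)) ∧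
        linearCombination S t Φ = φ := by
  refine ⟨fun h => ?_, fun ⟨t, ht, h⟩ => h ▸ linearCombination_mem_canonicalLaw ht⟩
  obtain ⟨w, hw, rfl⟩ := exists_of_mem_canonicalLaw hpos hfield h
  refine ⟨fun i => linearCombination S w (Ψ i), fun i hi => ?_, ?_⟩
  · have h : linearCombination S w (Ψ i) ∈
        canonicalLaw (linearCombination S (fun B => single B (1 : S)) (Ψ i)) := by
      refine linearCombination_mem_canonicalLaw fun B hB => simplex_subset_canonicalLaw (hw B ?_)
      refine mem_support_iff.2 fun h0 => mem_support_iff.1 hB ?_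
      exact hfield.eq_zero_of_mul_eq_zero (mem_support_iff.1 hi)
        (hpos.mul_eq_zero_of_linearCombination h0 hi)
    rwa [eq_linearCombination_single] at h
  · exact (apply_linearCombination S (linearCombination S w) Ψ Φ).symm

theorem mem_canonicalLaw_mapDomain (hpos : IsPositiveSemiring S) (hfield : IsSemifieldSemiring S)
    {I : Type*} {X : Type u} {g : I → Set X} {Φ : I →₀ S} {φ : X →₀ S} :
    φ ∈ canonicalLaw (mapDomain g Φ) ↔
      ∃ t : I → X →₀ S, (∀ i ∈ Φ.support, t i ∈ simplex (g i)) ∧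
        linearCombination S t Φ = φ := by
  rw [mapDomain_eq_linearCombination, mem_canonicalLaw_linearCombination hpos hfield]
  simp only [canonicalLaw_single hpos hfield]

theorem mem_canonicalLaw (hpos : IsPositiveSemiring S) (hfield : IsSemifieldSemiring S)
    {X : Type u} {Φ : Set X →₀ S} {φ : X →₀ S} :
    φ ∈ canonicalLaw Φ ↔
      ∃ t : Set X → X →₀ S, (∀ B ∈ Φ.support, t B ∈ simplex B) ∧
        linearCombination S t Φ = φ := by
  simpa using mem_canonicalLaw_mapDomain hpos hfield (g := id) (Φ := Φ) (φ := φ)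

/-- Convexity of the values of the law: with weights summing to one, a constant family `Ψ` combines
to itself. -/
theorem linearCombination_mem_canonicalLaw_of_totalWeight {I : Type*} {X : Type u}
    {t : I → X →₀ S} {Ψ : Set X →₀ S} {χ : I →₀ S} (hχ : totalWeight χ = 1)
    (h : ∀ i ∈ χ.support, t i ∈ canonicalLaw Ψ) : linearCombination S t χ ∈ canonicalLaw Ψ := by
  have := linearCombination_mem_canonicalLaw (Ψ := fun _ => Ψ) h
  rwa [linearCombination_const, hχ, one_smul] at this

/-! ### Convex hulls in a semimodule -/

section Hull

variable {M : Type*} [AddCommMonoid M] [Module S M]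

/-- The convex hull of a subset of a semimodule. -/
def mixtureHull (S : Type*) [Semiring S] {M : Type*} [AddCommMonoid M] [Module S M] (C : Set M) :
    Set M :=
  {y | ∃ φ : M →₀ S, φ ∈ simplex C ∧ linearCombination S id φ = y}

theorem linearCombination_mem_mixtureHull_of_mem {I : Type*} {C : Set M} {v : I → M} {φ : I →₀ S}
    (hφ : totalWeight φ = 1) (hv : ∀ i ∈ φ.support, v i ∈ C) :
    linearCombination S v φ ∈ mixtureHull S C :=
  ⟨mapDomain v φ, mapDomain_mem_simplex ⟨subset_rfl, hφ⟩ hv, by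
    rw [linearCombination_mapDomain]; rfl⟩

theorem linearCombination_mem_mixtureHull {I : Type*} {C : Set M} {v : I → M} {φ : I →₀ S}
    (hφ : totalWeight φ = 1) (hv : ∀ i ∈ φ.support, v i ∈ mixtureHull S C) :
    linearCombination S v φ ∈ mixtureHull S C := by
  choose! χ hχ using hv
  refine ⟨linearCombination S χ φ,
    linearCombination_mem_simplex hφ fun i hi => (hχ i hi).1, ?_⟩
  rw [apply_linearCombination]
  exact linearCombination_congr fun i hi => (hχ i hi).2

theorem subset_mixtureHull (C : Set M) : C ⊆ mixtureHull S C := fun c hc =>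
  ⟨single c 1, single_mem_simplex hc, by simp⟩

theorem linearCombination_add_apply {I : Type*} (v w : I → M) (φ : I →₀ S) :
    linearCombination S (fun i => v i + w i) φ =
      linearCombination S v φ + linearCombination S w φ := by
  simp only [linearCombination_apply, smul_add, Finsupp.sum_add]

/-- Since weights sum to one, a constant summand can be moved inside a mixture. Doing so for each
argument in turn never requires scalars to commute. -/
theorem add_mem_mixtureHull {C D E : Set M} (h : ∀ c ∈ C, ∀ d ∈ D, c + d ∈ E) {y z : M}
    (hy : y ∈ mixtureHull S C) (hz : z ∈ mixtureHull S D) : y + z ∈ mixtureHull S E := by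
  obtain ⟨φ, hφ, rfl⟩ := hy
  obtain ⟨χ, hχ, rfl⟩ := hz
  have hz : ∀ z : M, linearCombination S id φ + z = linearCombination S (fun c => c + z) φ := by
    intro z
    rw [linearCombination_add_apply, linearCombination_const, hφ.2, one_smul]; rfl
  rw [hz]
  refine linearCombination_mem_mixtureHull hφ.2 fun c hc => ?_
  have hc' : c + linearCombination S id χ = linearCombination S (fun d => c + d) χ := by
    rw [linearCombination_add_apply, linearCombination_const, hχ.2, one_smul]; rfl
  rw [hc']
  exact linearCombination_mem_mixtureHull_of_mem hχ.2 fun d hd => h c (hφ.1 hc) d (hχ.1 hd)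

/-- Without commutativity `r` cannot pass a coefficient `s`, but `r * s = (r * s * r⁻¹) * r`, and
the conjugated coefficients still sum to one. -/
theorem smul_mem_mixtureHull (hfield : IsSemifieldSemiring S) {r : S} (hr : r ≠ 0) {C E : Set M}
    (h : ∀ c ∈ C, r • c ∈ E) {y : M} (hy : y ∈ mixtureHull S C) :
    r • y ∈ mixtureHull S E := by
  obtain ⟨φ, hφ, rfl⟩ := hy
  obtain ⟨x, hx, hx'⟩ := hfield r hr
  let χ : M →₀ S := φ.mapRange (fun s => r * s * x) (by simp)
  have hχ : totalWeight χ = 1 := by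
    rw [totalWeight_apply, sum_mapRange_index fun _ => rfl, Finsupp.sum, ← Finset.sum_mul,
      ← Finset.mul_sum]
    have := hφ.2
    rw [totalWeight_apply, Finsupp.sum] at this
    rw [this, mul_one, hx]
  have : r • linearCombination S id φ = linearCombination S (fun c => r • c) χ := by
    rw [linearCombination_apply, linearCombination_apply,
      sum_mapRange_index (h := fun c s => s • r • c) fun _ => zero_smul _ _, smul_sum]
    refine Finset.sum_congr rfl fun c _ => ?_
    simp only [smul_smul, id, mul_assoc, hx', mul_one]
  rw [this]
  exact linearCombination_mem_mixtureHull_of_mem hχ fun c hc =>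
    h c (hφ.1 (support_mapRange hc))

/-- The indices of the support are added one at a time; on the support `Φ i ≠ 0`, so scaling by it
preserves hulls. -/
theorem linearCombination_mem_mixtureHull_choices (hfield : IsSemifieldSemiring S) {I : Type*}
    {C : I → Set M} {t : I → M} {Φ : I →₀ S} (ht : ∀ i ∈ Φ.support, t i ∈ mixtureHull S (C i)) :
    linearCombination S t Φ ∈
      mixtureHull S {y | ∃ v : I → M, (∀ i ∈ Φ.support, v i ∈ C i) ∧
        linearCombination S v Φ = y} := by
  classical
  have key : ∀ F ⊆ Φ.support, ∑ i ∈ F, Φ i • t i ∈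
      mixtureHull S {y | ∃ v : I → M, (∀ i ∈ F, v i ∈ C i) ∧ ∑ i ∈ F, Φ i • v i = y} := by
    intro F
    induction F using Finset.induction_on with
    | empty =>
      exact fun _ => subset_mixtureHull _ ⟨0, by simp, by simp⟩
    | insert i F hi ih =>
      intro hF
      rw [Finset.sum_insert hi]
      refine add_mem_mixtureHull (C := (Φ i • ·) '' C i) ?_
        (smul_mem_mixtureHull hfield (mem_support_iff.1 (hF (Finset.mem_insert_self i F)))
          (fun c hc => Set.mem_image_of_mem _ hc) (ht i (hF (Finset.mem_insert_self i F))))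
        (ih fun j hj => hF (Finset.mem_insert_of_mem hj))
      rintro _ ⟨c, hc, rfl⟩ _ ⟨v, hv, rfl⟩
      have hne : ∀ j ∈ F, Function.update v i c j = v j := fun j hj =>
        Function.update_of_ne (ne_of_mem_of_not_mem hj hi) _ _
      refine ⟨Function.update v i c, fun j hj => ?_, ?_⟩
      · rcases Finset.mem_insert.1 hj with rfl | hj
        · rwa [Function.update_self]
        · rw [hne j hj]
          exact hv j hj
      · rw [Finset.sum_insert hi, Function.update_self,
          Finset.sum_congr rfl fun j hj => by rw [hne j hj]]
  exact key Φ.support subset_rfl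

end Hull

/-! ### Choice functions and the convex closure formula -/

/-- Choices become Dirac functions defined for all sets `B`; a total choice with values in `X` could
fail to exist, as `X` may be empty. -/
theorem mem_choiceSet {X : Type u} {Φ : Set X →₀ S} {φ : X →₀ S} :
    φ ∈ choiceSet Φ ↔ ∃ v : Set X → X →₀ S,
      (∀ B ∈ Φ.support, v B ∈ (fun x => single x (1 : S)) '' B) ∧
        linearCombination S v Φ = φ := by
  have key : ∀ (u : {B // B ∈ Φ.support} → X) (v : Set X → X →₀ S),
      (∀ B, v B.1 = single (u B) 1) →
      mapDomain u (Φ.subtypeDomain (· ∈ Φ.support)) = linearCombination S v Φ := by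
    intro u v h
    rw [mapDomain_eq_linearCombination, linearCombination_apply, linearCombination_apply,
      ← sum_subtypeDomain_index (p := (· ∈ Φ.support)) (v := Φ) (h := fun B s => s • v B)
        fun B hB => hB]
    exact Finset.sum_congr rfl fun B _ => by simp only [h]
  constructor
  · rintro ⟨u, hu, rfl⟩
    -- Quantifying over `hB` inside lets `choose!` return a function of `B` alone.
    have h : ∀ B ∈ Φ.support, ∃ m : X →₀ S, ∀ hB : B ∈ Φ.support, m = single (u ⟨B, hB⟩) 1 :=
      fun B hB => ⟨single (u ⟨B, hB⟩) 1, fun _ => rfl⟩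
    choose! v hv using h
    refine ⟨v, fun B hB => ⟨u ⟨B, hB⟩, hu ⟨B, hB⟩, (hv B hB hB).symm⟩, (key u v fun B => ?_).symm⟩
    exact hv B.1 B.2 B.2
  · rintro ⟨v, hv, rfl⟩
    choose u hu using hv
    exact ⟨fun B => u B.1 B.2, fun B => (hu B.1 B.2).1, key _ v fun B => (hu B.1 B.2).2.symm⟩

theorem canonicalLaw_eq_mixtureHull (hpos : IsPositiveSemiring S) (hfield : IsSemifieldSemiring S)
    {X : Type u} (Φ : Set X →₀ S) : canonicalLaw Φ = mixtureHull S (choiceSet Φ) := by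
  refine Set.Subset.antisymm (fun φ hφ => ?_) ?_
  · obtain ⟨t, ht, rfl⟩ := exists_of_mem_canonicalLaw hpos hfield hφ
    have h := linearCombination_mem_mixtureHull_choices hfield (t := t) (Φ := Φ)
      (C := fun B => (fun x => single x (1 : S)) '' B) fun B hB => by
        rw [← eq_linearCombination_single (t B)]
        exact linearCombination_mem_mixtureHull_of_mem (ht B hB).2 fun x hx =>
          ⟨x, (ht B hB).1 hx, rfl⟩
    convert h using 2
    ext φ
    exact mem_choiceSet
  · rintro _ ⟨χ, hχ, rfl⟩
    refine linearCombination_mem_canonicalLaw_of_totalWeight hχ.2 fun φ hφ => ?_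
    obtain ⟨v, hv, h⟩ := mem_choiceSet.1 (hχ.1 hφ)
    refine (mem_canonicalLaw hpos hfield).2 ⟨v, fun B hB => ?_, h⟩
    obtain ⟨x, hx, h⟩ := hv B hB
    exact h ▸ single_mem_simplex hx

end Mixtures

/-! ### The axioms of the weak distributive law -/

section Law

open Finsupp

variable {S : Type u} [Semiring S]

theorem canonicalLaw_naturality (hpos : IsPositiveSemiring S) (hfield : IsSemifieldSemiring S)
    {X Y : Type u} (f : X → Y) (Φ : Set X →₀ S) :
    canonicalLaw (mapDomain (f '' ·) Φ) = mapDomain f '' canonicalLaw Φ := by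
  ext φ
  rw [mem_canonicalLaw_mapDomain hpos hfield]
  simp only [simplex_image, Set.mem_image, mem_canonicalLaw hpos hfield]
  constructor
  · rintro ⟨t, ht, rfl⟩
    choose! t' ht' using ht
    refine ⟨_, ⟨t', fun B hB => (ht' B hB).1, rfl⟩, ?_⟩
    rw [mapDomain_linearCombination]
    exact linearCombination_congr fun B hB => (ht' B hB).2
  · rintro ⟨_, ⟨t, ht, rfl⟩, rfl⟩
    exact ⟨fun B => mapDomain f (t B), fun B hB => ⟨t B, ht B hB, rfl⟩,
      (mapDomain_linearCombination f t Φ).symm⟩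

/-- This is the multiplication axiom at a Dirac function. A mixture over the union is split by
assigning to each point `x` of its support a member `B x` of `U` containing it. -/
theorem simplex_sUnion (hpos : IsPositiveSemiring S) (hfield : IsSemifieldSemiring S)
    {X : Type u} (U : Set (Set X)) :
    simplex (S := S) (⋃₀ U) = ⋃₀ (canonicalLaw '' simplex U) := by
  ext φ
  simp only [Set.sUnion_image, Set.mem_iUnion, exists_prop]
  constructor
  · intro hφ
    have h : ∀ x ∈ φ.support, ∃ B ∈ U, x ∈ B := fun x hx => hφ.1 hx
    choose! B hB using h
    refine ⟨mapDomain B φ, mapDomain_mem_simplex hφ fun x hx => (hB x hx).1, ?_⟩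
    exact (mem_canonicalLaw_mapDomain hpos hfield).2
      ⟨fun x => single x 1, fun x hx => single_mem_simplex (hB x hx).2,
        eq_linearCombination_single φ⟩
  · rintro ⟨w, hw, h⟩
    obtain ⟨t, ht, rfl⟩ := exists_of_mem_canonicalLaw hpos hfield h
    exact linearCombination_mem_simplex hw.2 fun B hB =>
      ⟨fun x hx => ⟨B, hw.1 hB, (ht B hB).1 hx⟩, (ht B hB).2⟩

theorem canonicalLaw_sUnion (hpos : IsPositiveSemiring S) (hfield : IsSemifieldSemiring S)
    {X : Type u} (Θ : Set (Set X) →₀ S) :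
    ⋃₀ (canonicalLaw '' canonicalLaw Θ) = canonicalLaw (mapDomain Set.sUnion Θ) := by
  ext φ
  rw [mem_canonicalLaw_mapDomain hpos hfield]
  simp only [simplex_sUnion hpos hfield, Set.sUnion_image, Set.mem_iUnion, exists_prop,
    mem_canonicalLaw hpos hfield (Φ := Θ)]
  constructor
  · rintro ⟨_, ⟨w, hw, rfl⟩, h⟩
    obtain ⟨t, ht, rfl⟩ := (mem_canonicalLaw_linearCombination hpos hfield).1 h
    exact ⟨t, fun U hU => ⟨w U, hw U hU, ht U hU⟩, rfl⟩
  · rintro ⟨t, ht, rfl⟩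
    choose! w hw using ht
    exact ⟨_, ⟨w, fun U hU => (hw U hU).1, rfl⟩,
      linearCombination_mem_canonicalLaw fun U hU => (hw U hU).2⟩

/-- The extra mixing on the left adds nothing, because the values of the law are convex; conversely,
Dirac functions are trivial mixtures. -/
theorem canonicalLaw_linComb (hpos : IsPositiveSemiring S) (hfield : IsSemifieldSemiring S)
    {X : Type u} (Ψ : (Set X →₀ S) →₀ S) :
    linComb '' canonicalLaw (mapDomain canonicalLaw Ψ) = canonicalLaw (linComb Ψ) := by
  ext φ
  rw [linComb_eq_linearCombination, mem_canonicalLaw_linearCombination hpos hfield]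
  simp only [Set.mem_image, mem_canonicalLaw_mapDomain hpos hfield]
  constructor
  · rintro ⟨_, ⟨t, ht, rfl⟩, rfl⟩
    refine ⟨fun Φ => linComb (t Φ), fun Φ hΦ => ?_, ?_⟩
    · exact linearCombination_mem_canonicalLaw_of_totalWeight (ht Φ hΦ).2 (ht Φ hΦ).1
    · exact (apply_linearCombination S (linearCombination S id) t Ψ).symm
  · rintro ⟨t, ht, rfl⟩
    refine ⟨_, ⟨fun Φ => single (t Φ) 1, fun Φ hΦ => single_mem_simplex (ht Φ hΦ), rfl⟩, ?_⟩
    rw [linComb_eq_linearCombination, apply_linearCombination]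
    exact linearCombination_congr fun Φ _ => linearCombination_single_one _ _

theorem canonicalLaw_mapDomain_singleton (hpos : IsPositiveSemiring S)
    (hfield : IsSemifieldSemiring S) {X : Type u} (φ : X →₀ S) :
    canonicalLaw (mapDomain (fun x => ({x} : Set X)) φ) = {φ} := by
  ext χ
  rw [mem_canonicalLaw_mapDomain hpos hfield, Set.mem_singleton_iff]
  constructor
  · rintro ⟨t, ht, rfl⟩
    rw [linearCombination_congr fun x hx => eq_single_of_mem_simplex (ht x hx)]
    exact eq_linearCombination_single φ
  · rintro rfl
    exact ⟨fun x => single x 1, fun x _ => single_mem_simplex rfl,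
      eq_linearCombination_single χ⟩

/-- The canonical weak distributive law of the powerset monad over the semimodule monad. -/
noncomputable def canonicalWeakDistributiveLaw (hpos : IsPositiveSemiring S)
    (hfield : IsSemifieldSemiring S) :
    WeakDistributiveLaw powersetMonad (semimoduleMonad S) where
  δ := { app := fun X => ↾fun Φ : Set X →₀ S => (canonicalLaw Φ : Set (X →₀ S))
         naturality := fun X Y f => by
          refine ConcreteCategory.hom_ext _ _ fun Φ => ?_
          exact canonicalLaw_naturality hpos hfield (fun x => f x) Φ }
  mul_left X := by
    refine ConcreteCategory.hom_ext _ _ fun Θ => ?_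
    exact canonicalLaw_sUnion hpos hfield Θ
  mul_right X := by
    refine ConcreteCategory.hom_ext _ _ fun Ψ => ?_
    exact canonicalLaw_linComb hpos hfield Ψ
  unit_left X := by
    refine ConcreteCategory.hom_ext _ _ fun φ => ?_
    exact canonicalLaw_mapDomain_singleton hpos hfield φ

theorem convexClosure_eq_image (A : (semimoduleMonad S).Algebra) (B : Set A.A) :
    convexClosure A B = (fun φ : A.A →₀ S => A.a φ) '' simplex B := by
  ext x
  simp only [convexClosure, simplex, totalWeight_apply, Set.mem_image, Set.mem_ofPred_eq, and_assoc]

theorem convexClosure_free {X : Type u} (C : Set (X →₀ S)) :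
    convexClosure ((semimoduleMonad S).free.obj X) C = mixtureHull S C :=
  convexClosure_eq_image ((semimoduleMonad S).free.obj X) C

end Law

/-! ### Convex closure in algebras -/

section Lifting

open Finsupp

variable {S : Type u} [Semiring S]

/-- The structure map of an algebra of the semimodule monad, as a function. -/
def evaluate (A : (semimoduleMonad S).Algebra) (φ : A.A →₀ S) : A.A := A.a φ

theorem evaluate_single (A : (semimoduleMonad S).Algebra) (x : A.A) :
    evaluate A (single x 1) = x :=
  ConcreteCategory.congr_hom A.unit x

theorem evaluate_linComb (A : (semimoduleMonad S).Algebra) (Ψ : (A.A →₀ S) →₀ S) :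
    evaluate A (linComb Ψ) = evaluate A (mapDomain (evaluate A) Ψ) :=
  ConcreteCategory.congr_hom A.assoc Ψ

theorem map_evaluate {A B : (semimoduleMonad S).Algebra} (f : A ⟶ B) (φ : A.A →₀ S) :
    f.f (evaluate A φ) = evaluate B (mapDomain (fun x => f.f x) φ) :=
  (ConcreteCategory.congr_hom f.h φ).symm

theorem evaluate_linearCombination (A : (semimoduleMonad S).Algebra) {I : Type*}
    (t : I → A.A →₀ S) (Φ : I →₀ S) :
    evaluate A (linearCombination S t Φ) =
      evaluate A (mapDomain (fun i => evaluate A (t i)) Φ) := by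
  have h := evaluate_linComb A (mapDomain t Φ)
  rw [linComb_eq_linearCombination, linearCombination_mapDomain, ← mapDomain_comp] at h
  exact h

theorem evaluate_mapDomain_congr (A : (semimoduleMonad S).Algebra) {I : Type*} {u v : I → A.A}
    {Φ : I →₀ S} (h : ∀ i ∈ Φ.support, u i = v i) :
    evaluate A (mapDomain u Φ) = evaluate A (mapDomain v Φ) := by
  rw [mapDomain_congr h]

theorem mem_convexClosure {A : (semimoduleMonad S).Algebra} {B : Set A.A} {x : A.A} :
    x ∈ convexClosure A B ↔ ∃ φ ∈ simplex B, evaluate A φ = x := by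
  rw [convexClosure_eq_image]; rfl

/-- Associativity of the algebra allows each component `t i` to be evaluated first, so only a point
of the closure of `g i` matters. -/
theorem mem_evaluate_canonicalLaw (hpos : IsPositiveSemiring S) (hfield : IsSemifieldSemiring S)
    {A : (semimoduleMonad S).Algebra} {I : Type*} {g : I → Set A.A} {Φ : I →₀ S} {x : A.A} :
    x ∈ evaluate A '' canonicalLaw (mapDomain g Φ) ↔
      ∃ u : I → A.A, (∀ i ∈ Φ.support, u i ∈ convexClosure A (g i)) ∧
        evaluate A (mapDomain u Φ) = x := by
  simp only [Set.mem_image, mem_canonicalLaw_mapDomain hpos hfield, mem_convexClosure]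
  constructor
  · rintro ⟨_, ⟨t, ht, rfl⟩, rfl⟩
    exact ⟨fun i => evaluate A (t i), fun i hi => ⟨t i, ht i hi, rfl⟩,
      (evaluate_linearCombination A t Φ).symm⟩
  · rintro ⟨u, hu, rfl⟩
    choose! t ht using hu
    refine ⟨_, ⟨t, fun i hi => (ht i hi).1, rfl⟩, ?_⟩
    rw [evaluate_linearCombination]
    exact evaluate_mapDomain_congr A fun i hi => (ht i hi).2

theorem subset_convexClosure (A : (semimoduleMonad S).Algebra) (B : Set A.A) :
    B ⊆ convexClosure A B := fun x hx =>
  mem_convexClosure.2 ⟨single x 1, single_mem_simplex hx, evaluate_single A x⟩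

theorem evaluate_mapDomain_mem_convexClosure {A : (semimoduleMonad S).Algebra} {B : Set A.A}
    {I : Type*} {u : I → A.A} {φ : I →₀ S} (hφ : totalWeight φ = 1)
    (hu : ∀ i ∈ φ.support, u i ∈ convexClosure A B) :
    evaluate A (mapDomain u φ) ∈ convexClosure A B := by
  simp only [mem_convexClosure] at hu
  choose! t ht using hu
  refine mem_convexClosure.2 ⟨linearCombination S t φ,
    linearCombination_mem_simplex hφ fun i hi => (ht i hi).1, ?_⟩
  rw [evaluate_linearCombination]
  exact evaluate_mapDomain_congr A fun i hi => (ht i hi).2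

theorem evaluate_mem_convexClosure {A : (semimoduleMonad S).Algebra} {B : Set A.A}
    {φ : A.A →₀ S} (hφ : totalWeight φ = 1)
    (h : ∀ x ∈ φ.support, x ∈ convexClosure A B) : evaluate A φ ∈ convexClosure A B := by
  have := evaluate_mapDomain_mem_convexClosure (u := id) hφ h
  rwa [mapDomain_id] at this

theorem convexClosure_idem (A : (semimoduleMonad S).Algebra) (B : Set A.A) :
    convexClosure A (convexClosure A B) = convexClosure A B := by
  refine Set.Subset.antisymm (fun x hx => ?_) (subset_convexClosure A _)
  obtain ⟨φ, hφ, rfl⟩ := mem_convexClosure.1 hx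
  exact evaluate_mem_convexClosure hφ.2 fun x hx => hφ.1 hx

theorem convexClosure_mono {A : (semimoduleMonad S).Algebra} {B C : Set A.A} (h : B ⊆ C) :
    convexClosure A B ⊆ convexClosure A C := fun _ hx =>
  let ⟨φ, hφ, h'⟩ := mem_convexClosure.1 hx
  mem_convexClosure.2 ⟨φ, ⟨hφ.1.trans h, hφ.2⟩, h'⟩

theorem convexClosure_image {A A' : (semimoduleMonad S).Algebra} (f : A ⟶ A') (B : Set A.A) :
    convexClosure A' ((fun x => f.f x) '' B) = (fun x => f.f x) '' convexClosure A B := by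
  ext y
  simp only [mem_convexClosure, Set.mem_image, simplex_image]
  constructor
  · rintro ⟨_, ⟨φ, hφ, rfl⟩, rfl⟩
    exact ⟨_, ⟨φ, hφ, rfl⟩, map_evaluate f φ⟩
  · rintro ⟨_, ⟨φ, hφ, rfl⟩, rfl⟩
    exact ⟨_, ⟨φ, hφ, rfl⟩, (map_evaluate f φ).symm⟩

theorem convexClosure_singleton (A : (semimoduleMonad S).Algebra) (x : A.A) :
    convexClosure A {x} = {x} := by
  refine Set.Subset.antisymm (fun y hy => ?_) (subset_convexClosure A _)
  obtain ⟨φ, hφ, rfl⟩ := mem_convexClosure.1 hy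
  rw [eq_single_of_mem_simplex hφ, evaluate_single]
  rfl

/-! ### The algebra of convex subsets -/

/-- The underlying set of a convex subset. -/
def ConvexSubset.carrier {A : (semimoduleMonad S).Algebra} (B : ConvexSubset A) : Set A.A := B.1

theorem ConvexSubset.convexClosure_carrier {A : (semimoduleMonad S).Algebra}
    (B : ConvexSubset A) : convexClosure A B.carrier = B.carrier := B.2.symm

/-- The convex closure as a convex subset. -/
def ConvexSubset.closure (A : (semimoduleMonad S).Algebra) (B : Set A.A) : ConvexSubset A :=
  ⟨convexClosure A B, (convexClosure_idem A B).symm⟩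

theorem ConvexSubset.ext {A : (semimoduleMonad S).Algebra} {B C : ConvexSubset A}
    (h : ∀ x, x ∈ B.carrier ↔ x ∈ C.carrier) : B = C :=
  Subtype.ext (Set.ext h)

theorem convexClosure_evaluate_canonicalLaw
    (A : (semimoduleMonad S).Algebra) (Φ : Set A.A →₀ S) :
    convexClosure A (evaluate A '' canonicalLaw Φ) = evaluate A '' canonicalLaw Φ := by
  refine Set.Subset.antisymm (fun x hx => ?_) (subset_convexClosure A _)
  obtain ⟨χ, hχ, rfl⟩ := mem_convexClosure.1 hx
  rw [simplex_image] at hχ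
  obtain ⟨Ψ, hΨ, rfl⟩ := hχ
  refine ⟨linComb Ψ, ?_, evaluate_linComb A Ψ⟩
  exact linearCombination_mem_canonicalLaw_of_totalWeight hΨ.2 fun φ hφ => hΨ.1 hφ

/-- The action of the semimodule monad on the convex subsets of an algebra. -/
def ConvexSubset.action (_hpos : IsPositiveSemiring S) (_hfield : IsSemifieldSemiring S)
    (A : (semimoduleMonad S).Algebra) (Φ : ConvexSubset A →₀ S) : ConvexSubset A :=
  ⟨evaluate A '' canonicalLaw (mapDomain ConvexSubset.carrier Φ),
    (convexClosure_evaluate_canonicalLaw A _).symm⟩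

theorem ConvexSubset.carrier_action (hpos : IsPositiveSemiring S)
    (hfield : IsSemifieldSemiring S) (A : (semimoduleMonad S).Algebra)
    (Φ : ConvexSubset A →₀ S) : (ConvexSubset.action hpos hfield A Φ).carrier =
      evaluate A '' canonicalLaw (mapDomain ConvexSubset.carrier Φ) := rfl

theorem ConvexSubset.mem_action_mapDomain (hpos : IsPositiveSemiring S)
    (hfield : IsSemifieldSemiring S) {A : (semimoduleMonad S).Algebra} {I : Type*}
    {g : I → ConvexSubset A} {Φ : I →₀ S} {x : A.A} :
    x ∈ (ConvexSubset.action hpos hfield A (mapDomain g Φ)).carrier ↔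
      ∃ u : I → A.A, (∀ i ∈ Φ.support, u i ∈ (g i).carrier) ∧
        evaluate A (mapDomain u Φ) = x := by
  rw [ConvexSubset.carrier_action, ← mapDomain_comp, mem_evaluate_canonicalLaw hpos hfield]
  simp only [Function.comp, ConvexSubset.convexClosure_carrier]

theorem ConvexSubset.mem_action (hpos : IsPositiveSemiring S)
    (hfield : IsSemifieldSemiring S) {A : (semimoduleMonad S).Algebra}
    {Φ : ConvexSubset A →₀ S} {x : A.A} :
    x ∈ (ConvexSubset.action hpos hfield A Φ).carrier ↔
      ∃ u : ConvexSubset A → A.A, (∀ B ∈ Φ.support, u B ∈ B.carrier) ∧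
        evaluate A (mapDomain u Φ) = x := by
  have := ConvexSubset.mem_action_mapDomain hpos hfield (g := id) (Φ := Φ) (x := x)
  rwa [mapDomain_id] at this

theorem ConvexSubset.action_single (hpos : IsPositiveSemiring S)
    (hfield : IsSemifieldSemiring S) (A : (semimoduleMonad S).Algebra) (B : ConvexSubset A) :
    ConvexSubset.action hpos hfield A (single B 1) = B := by
  refine ConvexSubset.ext fun x => ?_
  rw [ConvexSubset.carrier_action, mapDomain_single, canonicalLaw_single hpos hfield,
    ← ConvexSubset.convexClosure_carrier B, mem_convexClosure, B.convexClosure_carrier]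
  rfl

/-- Both sides choose an element of the law at each `Φ` in the support of `Ψ`; one combines before
evaluating, the other after. -/
theorem ConvexSubset.action_linComb (hpos : IsPositiveSemiring S)
    (hfield : IsSemifieldSemiring S) (A : (semimoduleMonad S).Algebra)
    (Ψ : (ConvexSubset A →₀ S) →₀ S) : ConvexSubset.action hpos hfield A (linComb Ψ) =
      ConvexSubset.action hpos hfield A (mapDomain (ConvexSubset.action hpos hfield A) Ψ) := by
  refine ConvexSubset.ext fun x => ?_
  rw [ConvexSubset.mem_action_mapDomain, ConvexSubset.carrier_action, linComb_eq_linearCombination,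
    mapDomain_linearCombination]
  simp only [Set.mem_image, mem_canonicalLaw_linearCombination hpos hfield,
    ConvexSubset.carrier_action]
  constructor
  · rintro ⟨_, ⟨t, ht, rfl⟩, rfl⟩
    exact ⟨fun Φ => evaluate A (t Φ), fun Φ hΦ => ⟨t Φ, ht Φ hΦ, rfl⟩,
      (evaluate_linearCombination A t Ψ).symm⟩
  · rintro ⟨u, hu, rfl⟩
    choose! t ht using hu
    refine ⟨_, ⟨t, fun i hi => (ht i hi).1, rfl⟩, ?_⟩
    rw [evaluate_linearCombination]
    exact evaluate_mapDomain_congr A fun i hi => (ht i hi).2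

/-- The algebra of convex subsets of an algebra of the semimodule monad. -/
noncomputable def convexAlgebra (hpos : IsPositiveSemiring S) (hfield : IsSemifieldSemiring S)
    (A : (semimoduleMonad S).Algebra) : (semimoduleMonad S).Algebra where
  A := ConvexSubset A
  a := ↾fun Φ : ConvexSubset A →₀ S => ConvexSubset.action hpos hfield A Φ
  unit := by
    refine ConcreteCategory.hom_ext _ _ fun B => ?_
    exact ConvexSubset.action_single hpos hfield A B
  assoc := by
    refine ConcreteCategory.hom_ext _ _ fun Ψ => ?_
    exact ConvexSubset.action_linComb hpos hfield A Ψ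

/-- The direct image of a convex subset. -/
def ConvexSubset.map {A A' : (semimoduleMonad S).Algebra} (f : A ⟶ A') (B : ConvexSubset A) :
    ConvexSubset A' :=
  ⟨(fun x => f.f x) '' B.1, by rw [convexClosure_image, ← B.2]⟩

theorem ConvexSubset.carrier_map {A A' : (semimoduleMonad S).Algebra} (f : A ⟶ A')
    (B : ConvexSubset A) : (ConvexSubset.map f B).carrier = (fun x => f.f x) '' B.carrier := rfl

theorem ConvexSubset.action_mapDomain_map (hpos : IsPositiveSemiring S)
    (hfield : IsSemifieldSemiring S) {A A' : (semimoduleMonad S).Algebra} (f : A ⟶ A')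
    (Φ : ConvexSubset A →₀ S) :
    ConvexSubset.action hpos hfield A' (mapDomain (ConvexSubset.map f) Φ) =
      ConvexSubset.map f (ConvexSubset.action hpos hfield A Φ) := by
  refine ConvexSubset.ext fun x => ?_
  rw [ConvexSubset.mem_action_mapDomain]
  simp only [ConvexSubset.carrier_map, Set.mem_image, ConvexSubset.mem_action]
  constructor
  · rintro ⟨u, hu, rfl⟩
    -- An algebra is never empty, as it contains the value of the zero combination; `choose!` needs
    -- such a default.
    have : Nonempty A.A := ⟨evaluate A 0⟩
    choose! w hw using hu
    refine ⟨_, ⟨w, fun B hB => (hw B hB).1, rfl⟩, ?_⟩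
    rw [map_evaluate, ← mapDomain_comp]
    exact evaluate_mapDomain_congr A' fun B hB => (hw B hB).2
  · rintro ⟨_, ⟨u, hu, rfl⟩, rfl⟩
    refine ⟨fun B => f.f (u B), fun B hB => ⟨u B, hu B hB, rfl⟩, ?_⟩
    rw [map_evaluate, ← mapDomain_comp]
    rfl

/-! ### The monad of convex subsets -/

/-- The functor sending an algebra to the algebra of its convex subsets. -/
noncomputable def convexFunctor (hpos : IsPositiveSemiring S) (hfield : IsSemifieldSemiring S) :
    (semimoduleMonad S).Algebra ⥤ (semimoduleMonad S).Algebra where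
  obj A := convexAlgebra hpos hfield A
  map {A A'} f :=
    { f := ↾fun B : ConvexSubset A => ConvexSubset.map f B
      h := by
        refine ConcreteCategory.hom_ext _ _ fun Φ => ?_
        exact ConvexSubset.action_mapDomain_map hpos hfield f Φ }
  map_id A := by
    refine Monad.Algebra.Hom.ext (ConcreteCategory.hom_ext _ _ fun B => Subtype.ext ?_)
    exact Set.image_id _
  map_comp f g := by
    refine Monad.Algebra.Hom.ext (ConcreteCategory.hom_ext _ _ fun B => Subtype.ext ?_)
    exact Set.image_comp (fun y => g.f y) (fun x => f.f x) _

/-- A singleton as a convex subset. -/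
def ConvexSubset.singleton (A : (semimoduleMonad S).Algebra) (x : A.A) : ConvexSubset A :=
  ⟨{x}, (convexClosure_singleton A x).symm⟩

theorem ConvexSubset.action_mapDomain_singleton (hpos : IsPositiveSemiring S)
    (hfield : IsSemifieldSemiring S) {A : (semimoduleMonad S).Algebra} (φ : A.A →₀ S) :
    ConvexSubset.action hpos hfield A (mapDomain (ConvexSubset.singleton A) φ) =
      ConvexSubset.singleton A (evaluate A φ) := by
  refine ConvexSubset.ext fun x => ?_
  rw [ConvexSubset.mem_action_mapDomain]
  constructor
  · rintro ⟨u, hu, rfl⟩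
    rw [evaluate_mapDomain_congr A (v := id) hu, mapDomain_id]
    rfl
  · rintro rfl
    exact ⟨id, fun x _ => rfl, by rw [mapDomain_id]⟩

/-- The unit of the monad of convex subsets. -/
noncomputable def convexUnit (hpos : IsPositiveSemiring S) (hfield : IsSemifieldSemiring S)
    (A : (semimoduleMonad S).Algebra) : A ⟶ convexAlgebra hpos hfield A where
  f := ↾fun x => ConvexSubset.singleton A x
  h := by
    refine ConcreteCategory.hom_ext _ _ fun φ => ?_
    exact ConvexSubset.action_mapDomain_singleton hpos hfield φ

/-- This gives both the compatibility of `π` with multiplication and the convexity of unions of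
convex families. For the harder inclusion, the weights `φ` of a point of the right side also mix the
closures of sets `B x` containing the points `x`. -/
theorem convexClosure_iUnion (hpos : IsPositiveSemiring S) (hfield : IsSemifieldSemiring S)
    {A : (semimoduleMonad S).Algebra} (U : Set (Set A.A)) :
    (⋃ B ∈ convexClosure (convexAlgebra hpos hfield A) (ConvexSubset.closure A '' U),
      ConvexSubset.carrier B) =
      convexClosure A (⋃₀ U) := by
  ext x
  simp only [Set.mem_iUnion, exists_prop]
  constructor
  · rintro ⟨_, hB, hx⟩
    obtain ⟨w, hw, rfl⟩ := mem_convexClosure.1 hB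
    obtain ⟨u, hu, rfl⟩ := (ConvexSubset.mem_action hpos hfield).1 hx
    refine evaluate_mapDomain_mem_convexClosure hw.2 fun C hC => ?_
    obtain ⟨B, hB, rfl⟩ := hw.1 hC
    exact convexClosure_mono (Set.subset_sUnion_of_mem hB) (hu _ hC)
  · intro hx
    obtain ⟨φ, hφ, rfl⟩ := mem_convexClosure.1 hx
    have h : ∀ x ∈ φ.support, ∃ B ∈ U, x ∈ B := fun x hx => hφ.1 hx
    choose! B hB using h
    refine ⟨ConvexSubset.action hpos hfield A
      (mapDomain (fun x => ConvexSubset.closure A (B x)) φ), ?_, ?_⟩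
    · exact mem_convexClosure.2 ⟨_, mapDomain_mem_simplex hφ fun x hx =>
        ⟨B x, (hB x hx).1, rfl⟩, rfl⟩
    · exact (ConvexSubset.mem_action_mapDomain hpos hfield).2
        ⟨id, fun x hx => subset_convexClosure A _ (hB x hx).2, by rw [mapDomain_id]⟩

theorem ConvexSubset.closure_carrier {A : (semimoduleMonad S).Algebra} (B : ConvexSubset A) :
    ConvexSubset.closure A B.carrier = B :=
  Subtype.ext B.2.symm

/-- The union of a convex set of convex subsets. -/
def ConvexSubset.union (hpos : IsPositiveSemiring S) (hfield : IsSemifieldSemiring S)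
    (A : (semimoduleMonad S).Algebra) (U : ConvexSubset (convexAlgebra hpos hfield A)) :
    ConvexSubset A :=
  ⟨⋃₀ (ConvexSubset.carrier '' U.carrier), by
    -- Closing sets that are already convex changes nothing, so `convexClosure_iUnion` applies to
    -- the carriers.
    have h : ConvexSubset.closure A '' (ConvexSubset.carrier '' U.carrier) = U.carrier := by
      refine (Set.image_image _ _ _).trans ?_
      exact (Set.image_congr fun B _ => ConvexSubset.closure_carrier B).trans (Set.image_id _)
    refine Eq.trans ?_ (convexClosure_iUnion hpos hfield _)
    refine (Set.sUnion_image _ _).trans ?_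
    refine congrArg (fun V : Set (ConvexSubset A) => ⋃ B ∈ V, B.carrier) ?_
    exact U.convexClosure_carrier.symm.trans (congrArg (convexClosure _) h.symm)⟩

theorem ConvexSubset.mem_union (hpos : IsPositiveSemiring S) (hfield : IsSemifieldSemiring S)
    {A : (semimoduleMonad S).Algebra} {U : ConvexSubset (convexAlgebra hpos hfield A)} {x : A.A} :
    x ∈ (ConvexSubset.union hpos hfield A U).carrier ↔
      ∃ B : ConvexSubset A, B ∈ U.carrier ∧ x ∈ B.carrier := by
  change x ∈ ⋃₀ (ConvexSubset.carrier '' U.carrier) ↔ _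
  constructor
  · rintro ⟨_, ⟨B, hB, rfl⟩, hx⟩
    exact ⟨B, hB, hx⟩
  · rintro ⟨B, hB, hx⟩
    exact ⟨_, ⟨B, hB, rfl⟩, hx⟩

/-- Choosing a point of a union amounts to choosing a member and then a point of it. -/
theorem ConvexSubset.action_mapDomain_union (hpos : IsPositiveSemiring S)
    (hfield : IsSemifieldSemiring S) {A : (semimoduleMonad S).Algebra}
    (Φ : ConvexSubset (convexAlgebra hpos hfield A) →₀ S) :
    ConvexSubset.action hpos hfield A (mapDomain (ConvexSubset.union hpos hfield A) Φ) =
      ConvexSubset.union hpos hfield A (ConvexSubset.action hpos hfield _ Φ) := by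
  refine ConvexSubset.ext fun x => ?_
  rw [ConvexSubset.mem_action_mapDomain, ConvexSubset.mem_union]
  simp only [ConvexSubset.mem_union]
  constructor
  · rintro ⟨u, hu, rfl⟩
    have : Nonempty (ConvexSubset A) := ⟨ConvexSubset.closure A ∅⟩
    choose! w hw using hu
    exact ⟨ConvexSubset.action hpos hfield A (mapDomain w Φ),
      (ConvexSubset.mem_action hpos hfield).2 ⟨w, fun U hU => (hw U hU).1, rfl⟩,
      (ConvexSubset.mem_action_mapDomain hpos hfield).2 ⟨u, fun U hU => (hw U hU).2, rfl⟩⟩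
  · rintro ⟨B, hB, hx⟩
    obtain ⟨w, hw, rfl⟩ := (ConvexSubset.mem_action hpos hfield).1 hB
    obtain ⟨u, hu, rfl⟩ := (ConvexSubset.mem_action_mapDomain hpos hfield (g := w)).1 hx
    exact ⟨u, fun U hU => ⟨w U, hw U hU, hu U hU⟩, rfl⟩

/-- The multiplication of the monad of convex subsets. -/
noncomputable def convexMul (hpos : IsPositiveSemiring S) (hfield : IsSemifieldSemiring S)
    (A : (semimoduleMonad S).Algebra) :
    convexAlgebra hpos hfield (convexAlgebra hpos hfield A) ⟶ convexAlgebra hpos hfield A where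
  f := ↾fun U : ConvexSubset (convexAlgebra hpos hfield A) => ConvexSubset.union hpos hfield A U
  h := by
    refine ConcreteCategory.hom_ext _ _ fun Φ => ?_
    exact ConvexSubset.action_mapDomain_union hpos hfield Φ

/-- The monad of convex subsets on the algebras of the semimodule monad. -/
noncomputable def convexMonad (hpos : IsPositiveSemiring S) (hfield : IsSemifieldSemiring S) :
    CategoryTheory.Monad (semimoduleMonad S).Algebra where
  toFunctor := convexFunctor hpos hfield
  η := { app := fun A => convexUnit hpos hfield A
         naturality := fun A A' f => by
          refine Monad.Algebra.Hom.ext (ConcreteCategory.hom_ext _ _ fun x => Subtype.ext ?_)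
          exact (Set.image_singleton (f := fun x => f.f x) (a := x)).symm }
  μ := { app := fun A => convexMul hpos hfield A
         naturality := fun A A' f => by
          refine Monad.Algebra.Hom.ext (ConcreteCategory.hom_ext _ _ fun U => ?_)
          refine ConvexSubset.ext fun x => ?_
          refine (ConvexSubset.mem_union hpos hfield).trans ?_
          constructor
          · rintro ⟨_, ⟨B, hB, rfl⟩, ⟨x, hx, rfl⟩⟩
            exact ⟨x, (ConvexSubset.mem_union hpos hfield).2 ⟨B, hB, hx⟩, rfl⟩
          · rintro ⟨x, hx, rfl⟩
            obtain ⟨B, hB, hx⟩ := (ConvexSubset.mem_union hpos hfield).1 hx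
            exact ⟨_, ⟨B, hB, rfl⟩, ⟨x, hx, rfl⟩⟩ }
  assoc A := by
    refine Monad.Algebra.Hom.ext (ConcreteCategory.hom_ext _ _ fun U => ?_)
    refine ConvexSubset.ext fun x => ?_
    refine (ConvexSubset.mem_union hpos hfield).trans
      (Iff.trans ?_ (ConvexSubset.mem_union hpos hfield).symm)
    constructor
    · rintro ⟨_, ⟨V, hV, rfl⟩, hx⟩
      obtain ⟨B, hB, hx⟩ := (ConvexSubset.mem_union hpos hfield).1 hx
      exact ⟨B, (ConvexSubset.mem_union hpos hfield).2 ⟨V, hV, hB⟩, hx⟩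
    · rintro ⟨B, hB, hx⟩
      obtain ⟨V, hV, hB⟩ := (ConvexSubset.mem_union hpos hfield).1 hB
      exact ⟨_, ⟨V, hV, rfl⟩, (ConvexSubset.mem_union hpos hfield).2 ⟨B, hB, hx⟩⟩
  left_unit A := by
    refine Monad.Algebra.Hom.ext (ConcreteCategory.hom_ext _ _ fun B => ?_)
    refine ConvexSubset.ext fun x => (ConvexSubset.mem_union hpos hfield).trans ?_
    constructor
    · rintro ⟨_, rfl, hx⟩
      exact hx
    · exact fun hx => ⟨B, rfl, hx⟩
  right_unit A := by
    refine Monad.Algebra.Hom.ext (ConcreteCategory.hom_ext _ _ fun B => ?_)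
    refine ConvexSubset.ext fun x => (ConvexSubset.mem_union hpos hfield).trans ?_
    constructor
    · rintro ⟨_, ⟨y, hy, rfl⟩, rfl⟩
      exact hy
    · exact fun hx => ⟨_, ⟨x, hx, rfl⟩, rfl⟩

/-! ### The weak lifting and its correspondence with the law -/

theorem convexClosure_eq_evaluate_canonicalLaw (hpos : IsPositiveSemiring S)
    (hfield : IsSemifieldSemiring S) (A : (semimoduleMonad S).Algebra) (B : Set A.A) :
    convexClosure A B = evaluate A '' canonicalLaw (single B 1) := by
  rw [canonicalLaw_single hpos hfield]
  exact convexClosure_eq_image A B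

theorem evaluate_free {I X : Type u} (t : I → X →₀ S) (Φ : I →₀ S) :
    evaluate ((semimoduleMonad S).free.obj X) (mapDomain t Φ) = linearCombination S t Φ :=
  (linComb_mapDomain S t Φ).trans (linearCombination_apply S Φ).symm

theorem mixtureHull_image_single {X : Type u} (B : Set X) :
    mixtureHull S ((fun x => (single x 1 : X →₀ S)) '' B) = simplex B := by
  ext χ
  unfold mixtureHull
  rw [simplex_image]
  constructor
  · rintro ⟨_, ⟨ψ, hψ, rfl⟩, rfl⟩
    rw [linearCombination_mapDomain]
    exact (eq_linearCombination_single ψ).symm ▸ hψ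
  · refine fun hχ => ⟨_, ⟨χ, hχ, rfl⟩, ?_⟩
    rw [linearCombination_mapDomain]
    exact eq_linearCombination_single χ

theorem convexClosure_free_image_single {X : Type u} (B : Set X) :
    convexClosure ((semimoduleMonad S).free.obj X) ((fun x => (single x 1 : X →₀ S)) '' B) =
      simplex B :=
  (convexClosure_free _).trans (mixtureHull_image_single B)

/-- In the free algebra the closure of the Dirac functions at points of `B` is `simplex B`, so
choosing points of these closures is choosing the family `t`. -/
theorem canonicalLaw_eq_action_free (hpos : IsPositiveSemiring S) (hfield : IsSemifieldSemiring S)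
    {X : Type u} (Φ : Set X →₀ S) :
    canonicalLaw Φ = (ConvexSubset.action hpos hfield ((semimoduleMonad S).free.obj X)
      (mapDomain (ConvexSubset.closure ((semimoduleMonad S).free.obj X))
        (mapDomain (fun B : Set X => (fun x => (single x 1 : X →₀ S)) '' B) Φ))).carrier := by
  ext φ
  rw [← mapDomain_comp, mem_canonicalLaw hpos hfield]
  refine Iff.trans ?_ (ConvexSubset.mem_action_mapDomain hpos hfield).symm
  refine exists_congr fun t => and_congr (forall₂_congr fun B _ => ?_) ?_
  · rw [← convexClosure_free_image_single B]
    rfl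
  · rw [← evaluate_free]
    rfl

/-- No hull of `choiceSet` is needed: every set in the support is convex, so a mixture of its
elements evaluates to one of them. -/
theorem evaluate_canonicalLaw_eq_choiceSet (hpos : IsPositiveSemiring S)
    (hfield : IsSemifieldSemiring S) {A : (semimoduleMonad S).Algebra} (Φ : ConvexSubset A →₀ S) :
    (ConvexSubset.action hpos hfield A Φ).carrier =
      evaluate A '' choiceSet (mapDomain ConvexSubset.carrier Φ) := by
  classical
  ext x
  rw [ConvexSubset.carrier_action]
  have hval : ∀ B ∈ (mapDomain ConvexSubset.carrier Φ).support, convexClosure A B = B := by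
    intro B hB
    obtain ⟨C, -, rfl⟩ := Finset.mem_image.1 (mapDomain_support hB)
    exact C.convexClosure_carrier
  have h := mem_evaluate_canonicalLaw hpos hfield (A := A) (g := id)
    (Φ := mapDomain ConvexSubset.carrier Φ) (x := x)
  rw [mapDomain_id] at h
  refine h.trans ?_
  simp only [Set.mem_image, mem_choiceSet]
  constructor
  · rintro ⟨u, hu, rfl⟩
    refine ⟨_, ⟨fun B => single (u B) 1, fun B hB => ⟨u B, ?_, rfl⟩, rfl⟩, ?_⟩
    · exact (hval B hB).subset (hu B hB)
    · rw [← mapDomain_eq_linearCombination]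
  · rintro ⟨_, ⟨v, hv, rfl⟩, rfl⟩
    have : Nonempty A.A := ⟨evaluate A 0⟩
    choose! u hu using hv
    refine ⟨u, fun B hB => ?_, ?_⟩
    · exact subset_convexClosure A _ (hu B hB).1
    · rw [mapDomain_eq_linearCombination,
        linearCombination_congr fun B hB => (hu B hB).2]

/-- The weak lifting of the powerset monad given by convex subsets. -/
noncomputable def convexWeakLifting (hpos : IsPositiveSemiring S) (hfield : IsSemifieldSemiring S) :
    WeakLifting powersetMonad (semimoduleMonad S) where
  lift := convexMonad hpos hfield
  ι := { app := fun A => ↾fun B : ConvexSubset A => (B.carrier : Set A.A)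
         naturality := fun A A' f => rfl }
  π := { app := fun A => ↾fun B : Set A.A => ConvexSubset.closure A B
         naturality := fun A A' f => by
          refine ConcreteCategory.hom_ext _ _ fun B => Subtype.ext ?_
          exact convexClosure_image f B }
  ι_π := by
    ext A : 2
    refine ConcreteCategory.hom_ext _ _ fun B => ?_
    exact ConvexSubset.closure_carrier B
  ι_mul A := rfl
  ι_unit A := rfl
  π_mul A := by
    refine ConcreteCategory.hom_ext _ _ fun U => Subtype.ext ?_
    refine Eq.trans ?_ (convexClosure_iUnion hpos hfield U)
    exact Set.sUnion_image _ _
  π_unit A := by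
    refine ConcreteCategory.hom_ext _ _ fun x => Subtype.ext ?_
    exact convexClosure_singleton A x

theorem convexWeakLifting_isInducedBy (hpos : IsPositiveSemiring S)
    (hfield : IsSemifieldSemiring S) :
    (convexWeakLifting hpos hfield).IsInducedBy (canonicalWeakDistributiveLaw hpos hfield) where
  splitting A := by
    refine ConcreteCategory.hom_ext _ _ fun B => ?_
    exact convexClosure_eq_evaluate_canonicalLaw hpos hfield A B
  action A := by
    refine ConcreteCategory.hom_ext _ _ fun Φ => ?_
    -- The set obtained is already convex, so the final `π` acts as the identity; likewise for
    -- `map`.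
    exact (ConvexSubset.closure_carrier (ConvexSubset.action hpos hfield A Φ)).symm
  map {A B} f := by
    refine ConcreteCategory.hom_ext _ _ fun C => ?_
    exact (ConvexSubset.closure_carrier (ConvexSubset.map f C)).symm
  law X := by
    refine ConcreteCategory.hom_ext _ _ fun Φ => ?_
    exact canonicalLaw_eq_action_free hpos hfield Φ

theorem convexWeakLifting_isConvexPowerset (hpos : IsPositiveSemiring S)
    (hfield : IsSemifieldSemiring S) : (convexWeakLifting hpos hfield).IsConvexPowerset where
  carrier _ := rfl
  ι_eq _ _ := rfl
  π_eq _ _ := rfl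
  action_eq _ Φ := evaluate_canonicalLaw_eq_choiceSet hpos hfield Φ
  map_eq _ _ := rfl
  unit_eq _ _ := rfl
  mul_eq _ _ := Set.sUnion_image _ _

end Lifting

theorem mainTheorem2 (S : Type u) [Semiring S]
    (hpos : IsPositiveSemiring S) (hfield : IsSemifieldSemiring S) :
    ∃ D : WeakDistributiveLaw powersetMonad (semimoduleMonad S),
      IsCanonicalLaw D ∧
      (∀ (X : Type u) (Φ : Set X →₀ S),
        D.δ.app X Φ = convexClosure ((semimoduleMonad S).free.obj X) (choiceSet Φ)) ∧
      ∃ L : WeakLifting powersetMonad (semimoduleMonad S),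
        L.IsInducedBy D ∧ L.IsConvexPowerset :=
  -- Canonicity is definitional: `canonicalLaw` is the Barr extension of membership, unfolded.
  ⟨canonicalWeakDistributiveLaw hpos hfield, fun _ _ => rfl,
    fun _ Φ => (canonicalLaw_eq_mixtureHull hpos hfield Φ).trans (convexClosure_free _).symm,
    convexWeakLifting hpos hfield, convexWeakLifting_isInducedBy hpos hfield,
    convexWeakLifting_isConvexPowerset hpos hfield⟩
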